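/- Let $\omega_0=\omega\in\{0,1\}^{\mathbb Z^2}$ be distributed according to the Bernoulli product measure $P_p$, $p\in[0,1]$ (each site is independently $1$ = open with probability $p$ and $0$ = closed with probability $1-p$). For $n\ge 1$ let $\omega_n$ be obtained from $\omega_{n-1}$ by keeping every $1$ and turning into $1$ every $0$ that has at least three $1$'s among its four nearest neighbours, and let $\omega_\infty=\lim_{n\to\infty}\omega_n$ (pointwise). Let $\mathbb Z^2_{cp}$ be the close-packed lattice, i.e. $\mathbb Z^2$ with the two diagonals of every unit face added as edges; write $o\leftrightarrow x$ if the origin $o$ and $x$ are joined by a path of open sites in $\mathbb Z^2_{cp}$ (end points included), and let $C_o=\{x: o\leftrightarrow x\}$. For $n\in[1,\infty]$ let $\theta(p,n)$ and $\tau_{p,n}(x)$ be the probabilities that $|C_o|=\infty$ and that $o\leftrightarrow x$ in the configuration $\omega_n$, and let $\theta(p)$ and $\tau_p(x)$ be the same probabilities for the initial configuration $\omega_0$. Let $p_c^*=\inf\{p\in[0,1]:\theta(p)>0\}$ be the critical value of independent site percolation on $\mathbb Z^2_{cp}$. With $\|x\|$ the Euclidean length, the correlation lengths $\xi(p),\xi(p,n)\in[0,\infty]$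 are defined by $$\xi(p)^{-1}=\lim\Big\{-\frac1{\|x\|}\log\tau_p(x)\Big\},\qquad \xi(p,n)^{-1}=\lim\Big\{-\frac1{\|x\|}\log\tau_{p,n}(x)\Big\}\qquad(\|x\|\to\infty),$$ whenever the limit exists, where $x\to\infty$ either without restriction or along a prescribed way of going to infinity (a filter on $\mathbb Z^2$ along which $\|x\|\to\infty$, for instance a lattice ray $v,2v,3v,\dots$). **Theorem.** There are constants $0<c_1,c_2<\infty$ such that for every $n\in[1,\infty]$: 1. $\theta(p)\le\theta(p,n)\le c_1\,\theta(p)$ for all $p\in(p_c^*,1]$; 2. $\tau_p(x)\le\tau_{p,n}(x)\le p^{-c_2}\,\tau_p(x)$ for all $p\in(0,p_c^*]$ and all $x\in\mathbb Z^2$; 3. $\xi(p,n)=\xi(p)$ for all $p\in(0,p_c^*]$: for the unrestricted limit, and likewise for every prescribed way of letting $\|x\|\to\infty$, one of the two correlation lengths exists if and only if the other does, and then they are equal. Moreover, along every lattice ray $v,2v,3v,\dots$ with $v\in\mathbb Z^2\setminus\{o\}$ both correlation lengths exist (and hence are equal). -/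

import Mathlib

namespace BootstrapPercolation

open MeasureTheory ProbabilityTheory Filter Topology unitInterval
open scoped ENNReal

/-- Sites of the lattice `ℤ²`. -/
abbrev Site : Type := ℤ × ℤ

/-- Configurations in `{0, 1}^{ℤ²}`; `true` is `1` (open) and `false` is `0` (closed). -/
abbrev Config : Type := Site → Bool

/-- The four `ℤ²`-neighbours of a site. -/
def neighbors (x : Site) : Finset Site :=
  {(x.1 + 1, x.2), (x.1 - 1, x.2), (x.1, x.2 + 1), (x.1, x.2 - 1)}

/-- The close-packed lattice `ℤ²_cp`: the square lattice with the two diagonals of each face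
added. Two distinct sites are adjacent when both coordinates differ by at most one. -/
def cpLattice : SimpleGraph Site where
  Adj x y := x ≠ y ∧ |x.1 - y.1| ≤ 1 ∧ |x.2 - y.2| ≤ 1
  symm := ⟨fun x y h => ⟨h.1.symm, by rw [abs_sub_comm]; exact h.2.1,
    by rw [abs_sub_comm]; exact h.2.2⟩⟩
  loopless := ⟨fun _ h => h.1 rfl⟩

/-- One update of the bootstrap dynamics: `1`'s are stable, and a `0` becomes `1` if at least
three of its four `ℤ²`-neighbours are `1`. -/
def step (ω : Config) : Config := fun x =>
  ω x || decide (3 ≤ ((neighbors x).filter fun y => ω y = true).card)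

open scoped Classical in
/-- The fully bootstrapped configuration: a site is `1` in the limit iff it is `1` at some finite
time (`1`'s are stable, so this is the pointwise limit of the configurations at finite times). -/
noncomputable def limitConfig (ω : Config) : Config := fun x => decide (∃ k : ℕ, step^[k] ω x = true)

/-- The configuration `ω_n` at time `n ∈ {0, 1, 2, …} ∪ {∞}` started from `ω`. -/
noncomputable def configAt (n : ℕ∞) (ω : Config) : Config :=
  match n with
  | ⊤ => limitConfig ω
  | (k : ℕ) => step^[k] ω

/-- The Bernoulli product measure `P_p` on configurations: the `ω x` are independent, and each is
`1` with probability `p` and `0` with probability `1 - p`. -/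
noncomputable def P (p : I) : Measure Config :=
  Measure.infinitePi fun _ : Site => bernoulliMeasure true false p

/-- `x` and `y` are joined by an open `*`-path: a self-avoiding path in `ℤ²_cp` all of whose sites,
end points included, are open. -/
def OpenConnected (ω : Config) (x y : Site) : Prop :=
  ∃ w : cpLattice.Walk x y, w.IsPath ∧ ∀ z ∈ w.support, ω z = true

/-- The open cluster of `x` in `ℤ²_cp`; it is empty when `x` is closed. -/
def cluster (ω : Config) (x : Site) : Set Site := {y | OpenConnected ω x y}

/-- `θ(p)`: the percolation probability of independent site percolation on `ℤ²_cp`. -/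
noncomputable def theta (p : I) : ℝ := (P p).real {ω | (cluster ω 0).Infinite}

/-- `θ(p,n)`: the percolation probability on `ℤ²_cp` of the bootstrapped model at time `n`. -/
noncomputable def thetaAt (p : I) (n : ℕ∞) : ℝ :=
  (P p).real {ω | (cluster (configAt n ω) 0).Infinite}

/-- `τ_p(x)`: the probability that the origin and `x` are in the same open cluster for independent
site percolation on `ℤ²_cp`. -/
noncomputable def tau (p : I) (x : Site) : ℝ := (P p).real {ω | OpenConnected ω 0 x}

/-- `τ_{p,n}(x)`: the probability that the origin and `x` are in the same open cluster of `ℤ²_cp`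
for the bootstrapped model at time `n`. -/
noncomputable def tauAt (p : I) (n : ℕ∞) (x : Site) : ℝ :=
  (P p).real {ω | OpenConnected (configAt n ω) 0 x}

/-- `p_c^*`: the critical value of independent site percolation on `ℤ²_cp`. -/
noncomputable def pcStar : ℝ := sInf {q : ℝ | ∃ p : I, (p : ℝ) = q ∧ 0 < theta p}

/-- The Euclidean length of a site. -/
noncomputable def euclideanLength (x : Site) : ℝ := √((x.1 : ℝ) ^ 2 + (x.2 : ℝ) ^ 2)

/-- The filter of the limit `‖x‖ → ∞` over sites `x`. -/
noncomputable def atInfinity : Filter Site := comap euclideanLength atTop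

/-- The limit along the lattice ray `v, 2v, 3v, …`. -/
def alongRay (v : Site) : Filter Site := map (fun k : ℕ => k • v) atTop

/-- `ξ ∈ [0, ∞]` is the correlation length of the connectivity function `τ` as `x → ∞` along `l`:
the limit of `-‖x‖⁻¹ log τ(x)` along `l` exists and equals `ξ⁻¹`. For `l = atInfinity` this is the
full limit `‖x‖ → ∞`; for `l = alongRay v` it is the limit in the direction `v`. Connectivity
functions take values in `[0, 1]`, so the quantity is nonnegative. -/
def IsCorrelationLength (l : Filter Site) (τ : Site → ℝ) (ξ : ℝ≥0∞) : Prop :=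
  Tendsto (fun x => ENNReal.ofReal (-(1 / euclideanLength x) * Real.log (τ x))) l (𝓝 ξ⁻¹)

end BootstrapPercolation

open BootstrapPercolation
open scoped unitInterval ENNReal

/-!
Opening a closed site with three open neighbours never joins two different `*`-clusters: the open
neighbours of the site are already connected to each other, and everything `*`-adjacent to the site
is equal or `*`-adjacent to one of them. A whole parallel update therefore preserves the connections
between initially open sites (`openConnected_of_configAt`). Moreover a newly opened site lies between
two opposite open neighbours, so a cluster never leaves its bounding rectangle and a finite cluster
stays finite (`infinite_cluster_of_configAt`).

Consequently, if the origin and `x` are connected at time `n`, then by monotonicity of the dynamics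
they are also connected at time `n` for the configuration in which these two sites are opened by
hand, and hence they are connected in that initial configuration. Opening a site by hand costs a
factor `p⁻¹` (`mul_measure_update_le`), which gives `τ_{p,n} ≤ p⁻² τ_p` and `θ(p,n) ≤ p⁻¹ θ(p)`. The
last factor is made uniform in `p` by the path-counting bound `θ(p) = 0` for `p < 1/9`
(`theta_eq_zero`).

The two connectivity functions agree up to a factor independent of `x`, so their logarithms divided
by `‖x‖` have the same limits. Along a lattice ray the limit exists by Fekete's lemma, since `τ_p` is
supermultiplicative by the Harris inequality (`harris`) and translation invariance.
-/

namespace BootstrapPercolation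

open MeasureTheory ProbabilityTheory Filter Topology unitInterval
open scoped ENNReal

/-! ### Open connections -/

theorem OpenConnected.of_walk {ω : Config} {x y : Site} (w : cpLattice.Walk x y)
    (hw : ∀ z ∈ w.support, ω z = true) : OpenConnected ω x y := by
  classical
  exact ⟨w.bypass, w.bypass_isPath, fun z hz => hw z (w.support_bypass_subset_support hz)⟩

theorem OpenConnected.refl {ω : Config} {x : Site} (hx : ω x = true) : OpenConnected ω x x :=
  .of_walk .nil (by simpa using hx)

theorem OpenConnected.symm {ω : Config} {x y : Site} (h : OpenConnected ω x y) :
    OpenConnected ω y x := by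
  obtain ⟨w, -, hw⟩ := h
  exact .of_walk w.reverse (by simpa using hw)

theorem OpenConnected.trans {ω : Config} {x y z : Site} (h : OpenConnected ω x y)
    (h' : OpenConnected ω y z) : OpenConnected ω x z := by
  obtain ⟨w, -, hw⟩ := h
  obtain ⟨w', -, hw'⟩ := h'
  refine .of_walk (w.append w') fun u hu => ?_
  rcases (SimpleGraph.Walk.mem_support_append_iff _ _).1 hu with hu | hu
  · exact hw u hu
  · exact hw' u hu

theorem OpenConnected.left {ω : Config} {x y : Site} (h : OpenConnected ω x y) : ω x = true := by
  obtain ⟨w, -, hw⟩ := h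
  exact hw _ w.start_mem_support

theorem OpenConnected.right {ω : Config} {x y : Site} (h : OpenConnected ω x y) : ω y = true :=
  h.symm.left

theorem OpenConnected.mono {ω ω' : Config} (hω : ω ≤ ω') {x y : Site} (h : OpenConnected ω x y) :
    OpenConnected ω' x y := by
  obtain ⟨w, hp, hw⟩ := h
  exact ⟨w, hp, fun z hz => hω z (hw z hz)⟩

theorem cluster_mono {ω ω' : Config} (hω : ω ≤ ω') (x : Site) : cluster ω x ⊆ cluster ω' x :=
  fun _ h => h.mono hω

/-- Two sites are near each other if they are equal or adjacent in `ℤ²_cp`. -/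
def Near (x y : Site) : Prop := |x.1 - y.1| ≤ 1 ∧ |x.2 - y.2| ≤ 1

theorem OpenConnected.of_near {ω : Config} {x y : Site} (hx : ω x = true) (hy : ω y = true)
    (h : Near x y) : OpenConnected ω x y := by
  by_cases hxy : x = y
  · subst hxy; exact .refl hx
  · exact .of_walk (SimpleGraph.Walk.cons (show cpLattice.Adj x y from ⟨hxy, h⟩) .nil)
      (by simp [hx, hy])

/-- Induction along an open path: a set of sites that contains `x` and is closed under passing to
open nearby sites contains everything `x` is connected to. -/
theorem OpenConnected.mem_of_closed {ω : Config} {x y : Site} (h : OpenConnected ω x y)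
    (D : Set Site) (hx : x ∈ D) (hD : ∀ u v, u ∈ D → Near u v → ω v = true → v ∈ D) : y ∈ D := by
  obtain ⟨w, -, hw⟩ := h
  induction w with
  | nil => exact hx
  | cons h w ih =>
    refine ih (hD _ _ hx h.2 (hw _ (by simp))) fun z hz => hw z (by simp [hz])

/-! ### The bootstrap dynamics -/

theorem le_step (ω : Config) : ω ≤ step ω := fun x h => by simp [step, h]

theorem step_mono : Monotone step := by
  intro ω ω' h x hx
  simp only [step, Bool.or_eq_true, decide_eq_true_eq] at hx ⊢
  refine hx.imp (h x) fun hx => hx.trans (Finset.card_le_card ?_)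
  exact Finset.monotone_filter_right _ fun y _ hy => h y hy

theorem iterate_step_mono_time (ω : Config) : Monotone fun k => step^[k] ω :=
  monotone_nat_of_le_succ fun k => by
    rw [Function.iterate_succ_apply']; exact le_step _

theorem configAt_top_eq_true_iff (ω : Config) (x : Site) :
    configAt ⊤ ω x = true ↔ ∃ k, step^[k] ω x = true := by
  classical
  simp only [configAt]
  exact (decide_eq_true_iff (p := ∃ k, step^[k] ω x = true))

theorem le_configAt (n : ℕ∞) (ω : Config) : ω ≤ configAt n ω := by
  cases n with
  | top => exact fun x hx => (configAt_top_eq_true_iff ω x).2 ⟨0, hx⟩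
  | coe k => exact iterate_step_mono_time ω (Nat.zero_le k)

theorem configAt_mono (n : ℕ∞) : Monotone (configAt n) := by
  intro ω ω' h
  cases n with
  | top =>
    intro x hx
    obtain ⟨k, hk⟩ := (configAt_top_eq_true_iff ω x).1 hx
    exact (configAt_top_eq_true_iff ω' x).2 ⟨k, step_mono.iterate k h x hk⟩
  | coe k => exact step_mono.iterate k h

/-- A path is finite, so it is open in the limit only if it is open at some finite time. -/
theorem exists_openConnected_iterate {n : ℕ∞} {ω : Config} {x y : Site}
    (h : OpenConnected (configAt n ω) x y) : ∃ k, OpenConnected (step^[k] ω) x y := by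
  cases n with
  | coe k => exact ⟨k, h⟩
  | top =>
    obtain ⟨w, hp, hw⟩ := h
    have hw' : ∀ z ∈ w.support, ∃ k, step^[k] ω z = true := fun z hz =>
      (configAt_top_eq_true_iff ω z).1 (hw z hz)
    choose! k hk using hw'
    refine ⟨w.support.toFinset.sup k, w, hp, fun z hz => ?_⟩
    exact iterate_step_mono_time ω (Finset.le_sup (by simpa using hz)) z (hk z hz)

/-- The sites of `ω` that a site open in `step ω` is attached to: the site itself if it is open,
and its open `ℤ²`-neighbours. -/
def anchors (ω : Config) (z : Site) : Set Site := {u | ω u = true ∧ (u = z ∨ u ∈ neighbors z)}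

/-- The four ways in which three out of four neighbours can be open. -/
theorem step_eq_true_iff (ω : Config) (x : Site) : step ω x = true ↔ ω x = true ∨
    (ω (x.1 + 1, x.2) = true ∧ ω (x.1 - 1, x.2) = true ∧ ω (x.1, x.2 + 1) = true) ∨
    (ω (x.1 + 1, x.2) = true ∧ ω (x.1 - 1, x.2) = true ∧ ω (x.1, x.2 - 1) = true) ∨
    (ω (x.1 + 1, x.2) = true ∧ ω (x.1, x.2 + 1) = true ∧ ω (x.1, x.2 - 1) = true) ∨
    (ω (x.1 - 1, x.2) = true ∧ ω (x.1, x.2 + 1) = true ∧ ω (x.1, x.2 - 1) = true) := by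
  obtain ⟨a, b⟩ := x
  have h1 : ((a + 1, b) : Site) ∉ ({(a - 1, b), (a, b + 1), (a, b - 1)} : Finset Site) := by
    simp; omega
  have h2 : ((a - 1, b) : Site) ∉ ({(a, b + 1), (a, b - 1)} : Finset Site) := by simp
  have h3 : ((a, b + 1) : Site) ∉ ({(a, b - 1)} : Finset Site) := by simp; omega
  simp only [step, neighbors, Bool.or_eq_true, decide_eq_true_eq, Finset.card_filter]
  -- the four neighbours are distinct, so the count is a sum of four indicators
  rw [Finset.sum_insert h1, Finset.sum_insert h2, Finset.sum_insert h3, Finset.sum_singleton]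
  cases ω (a + 1, b) <;> cases ω (a - 1, b) <;> cases ω (a, b + 1) <;> cases ω (a, b - 1) <;> simp

/-- All anchors of a site of `step ω` lie in one cluster of `ω`. -/
theorem openConnected_of_mem_anchors {ω : Config} {z u v : Site} (hz : step ω z = true)
    (hu : u ∈ anchors ω z) (hv : v ∈ anchors ω z) : OpenConnected ω u v := by
  obtain ⟨a, b⟩ := z
  simp only [step_eq_true_iff] at hz
  simp only [anchors, neighbors, Set.mem_ofPred_eq, Finset.mem_insert, Finset.mem_singleton] at hu hv
  -- Every anchor is connected to one common anchor `h`: to `z` if it is open, and otherwise to the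
  -- middle one of three consecutive open neighbours; the fourth neighbour needs one extra step.
  obtain ⟨h, hh⟩ : ∃ h, ∀ u, ω u = true → (u = (a, b) ∨ u = (a + 1, b) ∨ u = (a - 1, b) ∨
      u = (a, b + 1) ∨ u = (a, b - 1)) → OpenConnected ω h u := by
    have key : ∀ u v : Site, ω u = true → ω v = true → |u.1 - v.1| ≤ 1 → |u.2 - v.2| ≤ 1 →
      OpenConnected ω u v := fun u v hu hv h1 h2 => .of_near hu hv ⟨h1, h2⟩
    have tr : ∀ u v w : Site, OpenConnected ω u v → OpenConnected ω v w → OpenConnected ω u w :=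
      fun _ _ _ => .trans
    rcases hz with h0 | ⟨h1, h2, h3⟩ | ⟨h1, h2, h3⟩ | ⟨h1, h2, h3⟩ | ⟨h1, h2, h3⟩
    · refine ⟨(a, b), ?_⟩
      rintro u hu (rfl | rfl | rfl | rfl | rfl) <;> exact key _ _ h0 hu (by simp) (by simp)
    · refine ⟨(a, b + 1), ?_⟩
      rintro u hu (rfl | rfl | rfl | rfl | rfl)
      on_goal 5 =>
        exact tr _ (a + 1, b) _ (key _ _ h3 h1 (by simp) (by simp))
          (key _ _ h1 hu (by simp) (by simp))
      all_goals exact key _ _ h3 hu (by simp) (by simp)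
    · refine ⟨(a, b - 1), ?_⟩
      rintro u hu (rfl | rfl | rfl | rfl | rfl)
      on_goal 4 =>
        exact tr _ (a + 1, b) _ (key _ _ h3 h1 (by simp) (by simp))
          (key _ _ h1 hu (by simp) (by simp))
      all_goals exact key _ _ h3 hu (by simp) (by simp)
    · refine ⟨(a + 1, b), ?_⟩
      rintro u hu (rfl | rfl | rfl | rfl | rfl)
      on_goal 3 =>
        exact tr _ (a, b + 1) _ (key _ _ h1 h2 (by simp) (by simp))
          (key _ _ h2 hu (by simp) (by simp))
      all_goals exact key _ _ h1 hu (by simp) (by simp)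
    · refine ⟨(a - 1, b), ?_⟩
      rintro u hu (rfl | rfl | rfl | rfl | rfl)
      on_goal 2 =>
        exact tr _ (a, b + 1) _ (key _ _ h1 h2 (by simp) (by simp))
          (key _ _ h2 hu (by simp) (by simp))
      all_goals exact key _ _ h1 hu (by simp) (by simp)
  exact (hh u hu.1 hu.2).symm.trans (hh v hv.1 hv.2)

/-- Among the anchors of two nearby sites of `step ω` there are two that are near each other. -/
theorem exists_near_anchors {ω : Config} {z z' : Site} (hz : step ω z = true)
    (hz' : step ω z' = true) (h : Near z z') :
    ∃ u ∈ anchors ω z, ∃ u' ∈ anchors ω z', Near u u' := by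
  obtain ⟨a, b⟩ := z
  obtain ⟨c, d⟩ := z'
  rw [step_eq_true_iff] at hz hz'
  by_contra! hcon
  have key : ∀ u u' : Site, (u = (a, b) ∨ u ∈ neighbors (a, b)) →
      (u' = (c, d) ∨ u' ∈ neighbors (c, d)) → Near u u' → ¬ (ω u = true ∧ ω u' = true) :=
    fun u u' hu hu' hn ho => hcon u ⟨ho.1, hu⟩ u' ⟨ho.2, hu'⟩ hn
  obtain ⟨h1, h2⟩ := h
  -- For each relative position of `z` and `z'`, a few candidate pairs suffice: pairs that include
  -- `z` or `z'`, a common neighbour, or two neighbours on the same side of `z` and `z'`.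
  obtain rfl | rfl | rfl : c = a - 1 ∨ a = c ∨ c = a + 1 := by
    simp only [abs_le] at h1; omega
  all_goals
    obtain rfl | rfl | rfl : d = b - 1 ∨ b = d ∨ d = b + 1 := by
      simp only [abs_le] at h2; omega
  all_goals
    clear hcon h1 h2
    simp only [neighbors, Finset.mem_insert, Finset.mem_singleton, sub_add_cancel,
      add_sub_cancel_right] at hz hz' key
  · have k0 := key (a, b) (a - 1, b - 1) (by simp) (by simp) (by simp [Near])
    have k1 := key (a - 1, b) (a - 1, b) (by simp) (by simp) (by simp [Near])
    have k2 := key (a, b - 1) (a, b - 1) (by simp) (by simp) (by simp [Near])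
    clear key
    grind
  · have k0 := key (a, b) (a, b) (by simp) (by simp) (by simp [Near])
    have k1 := key (a - 1, b) (a - 1, b) (by simp) (by simp) (by simp [Near])
    have k2 := key (a, b + 1) (a - 1, b + 1) (by simp) (by simp) (by simp [Near])
    clear key
    grind
  · have k0 := key (a, b) (a - 1, b + 1) (by simp) (by simp) (by simp [Near])
    have k1 := key (a - 1, b) (a - 1, b) (by simp) (by simp) (by simp [Near])
    have k2 := key (a, b + 1) (a, b + 1) (by simp) (by simp) (by simp [Near])
    clear key
    grind
  · have k0 := key (a, b) (a, b) (by simp) (by simp) (by simp [Near])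
    have k1 := key (a, b - 1) (a, b - 1) (by simp) (by simp) (by simp [Near])
    have k2 := key (a + 1, b) (a + 1, b - 1) (by simp) (by simp) (by simp [Near])
    clear key
    grind
  · have k0 := key (a, b) (a, b) (by simp) (by simp) (by simp [Near])
    have k1 := key (a + 1, b) (a + 1, b) (by simp) (by simp) (by simp [Near])
    have k2 := key (a, b + 1) (a, b + 1) (by simp) (by simp) (by simp [Near])
    have k3 := key (a - 1, b) (a - 1, b) (by simp) (by simp) (by simp [Near])
    clear key
    grind
  · have k0 := key (a, b) (a, b) (by simp) (by simp) (by simp [Near])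
    have k1 := key (a, b + 1) (a, b + 1) (by simp) (by simp) (by simp [Near])
    have k2 := key (a + 1, b) (a + 1, b + 1) (by simp) (by simp) (by simp [Near])
    clear key
    grind
  · have k0 := key (a, b) (a + 1, b - 1) (by simp) (by simp) (by simp [Near])
    have k1 := key (a + 1, b) (a + 1, b) (by simp) (by simp) (by simp [Near])
    have k2 := key (a, b - 1) (a, b - 1) (by simp) (by simp) (by simp [Near])
    clear key
    grind
  · have k0 := key (a, b) (a, b) (by simp) (by simp) (by simp [Near])
    have k1 := key (a + 1, b) (a + 1, b) (by simp) (by simp) (by simp [Near])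
    have k2 := key (a, b + 1) (a + 1, b + 1) (by simp) (by simp) (by simp [Near])
    clear key
    grind
  · have k0 := key (a, b) (a + 1, b + 1) (by simp) (by simp) (by simp [Near])
    have k1 := key (a + 1, b) (a + 1, b) (by simp) (by simp) (by simp [Near])
    have k2 := key (a, b + 1) (a, b + 1) (by simp) (by simp) (by simp [Near])
    clear key
    grind

/-! ### Clusters under the dynamics -/

/-- The anchors of every site that `x` is connected to in `step ω` lie in the cluster of `x` in
`ω`. -/
theorem anchors_subset_cluster {ω : Config} {x y : Site} (hx : ω x = true)
    (h : OpenConnected (step ω) x y) : anchors ω y ⊆ cluster ω x := by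
  have hxx := le_step ω x hx
  refine (h.mem_of_closed {z | step ω z = true ∧ anchors ω z ⊆ cluster ω x} ⟨hxx, fun u hu => ?_⟩
    fun z z' hz hn hz' => ⟨hz', fun v hv => ?_⟩).2
  · exact openConnected_of_mem_anchors hxx ⟨hx, .inl rfl⟩ hu
  · obtain ⟨u, hu, u', hu', hn'⟩ := exists_near_anchors hz.1 hz' hn
    exact ((hz.2 hu).trans (.of_near hu.1 hu'.1 hn')).trans
      (openConnected_of_mem_anchors hz' hu' hv)

theorem openConnected_of_step {ω : Config} {x y : Site} (hx : ω x = true) (hy : ω y = true)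
    (h : OpenConnected (step ω) x y) : OpenConnected ω x y :=
  anchors_subset_cluster hx h ⟨hy, .inl rfl⟩

/-- The dynamics does not join different clusters: two sites that are open initially are connected
at time `n` only if they are connected initially. -/
theorem openConnected_of_configAt {n : ℕ∞} {ω : Config} {x y : Site} (hx : ω x = true)
    (hy : ω y = true) (h : OpenConnected (configAt n ω) x y) : OpenConnected ω x y := by
  obtain ⟨k, hk⟩ := exists_openConnected_iterate h
  clear h
  induction k with
  | zero => exact hk
  | succ k ih =>
    rw [Function.iterate_succ_apply'] at hk
    exact ih (openConnected_of_step (iterate_step_mono_time ω (Nat.zero_le k) x hx)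
      (iterate_step_mono_time ω (Nat.zero_le k) y hy) hk)

/-- A site that opens lies between two opposite open neighbours, so one update keeps a cluster
within any rectangle that contains it. -/
theorem cluster_step_subset_Icc {ω : Config} {x a b : Site} (hx : ω x = true)
    (h : cluster ω x ⊆ Set.Icc a b) : cluster (step ω) x ⊆ Set.Icc a b := by
  intro y hy
  have hA := (anchors_subset_cluster hx hy).trans h
  obtain ⟨c, d⟩ := y
  have key : ∀ u : Site, ω u = true → u ∈ neighbors (c, d) → u ∈ Set.Icc a b :=
    fun u hu hn => hA ⟨hu, .inr hn⟩
  simp only [Set.mem_Icc, Prod.le_def] at key ⊢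
  rcases (step_eq_true_iff ω (c, d)).1 hy.right with h0 | ⟨h1, h2, h3⟩ | ⟨h1, h2, h3⟩ |
    ⟨h1, h2, h3⟩ | ⟨h1, h2, h3⟩
  · exact hA ⟨h0, .inl rfl⟩
  all_goals
    have k1 := key _ h1 (by simp [neighbors])
    have k2 := key _ h2 (by simp [neighbors])
    have k3 := key _ h3 (by simp [neighbors])
    simp only at k1 k2 k3
    omega

theorem cluster_configAt_subset_Icc {n : ℕ∞} {ω : Config} {x a b : Site} (hx : ω x = true)
    (h : cluster ω x ⊆ Set.Icc a b) : cluster (configAt n ω) x ⊆ Set.Icc a b := by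
  intro y hy
  obtain ⟨k, hk⟩ := exists_openConnected_iterate hy
  clear hy
  suffices ∀ k, cluster (step^[k] ω) x ⊆ Set.Icc a b from this k hk
  intro k
  induction k with
  | zero => exact h
  | succ k ih =>
    rw [Function.iterate_succ_apply']
    exact cluster_step_subset_Icc (iterate_step_mono_time ω (Nat.zero_le k) x hx) ih

/-- A finite cluster stays within its bounding rectangle, hence stays finite. -/
theorem infinite_cluster_of_configAt {n : ℕ∞} {ω : Config} {x : Site} (hx : ω x = true)
    (h : (cluster (configAt n ω) x).Infinite) : (cluster ω x).Infinite := by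
  intro hfin
  obtain ⟨a, ha⟩ := hfin.bddBelow
  obtain ⟨b, hb⟩ := hfin.bddAbove
  exact h ((Set.finite_Icc a b).subset
    (cluster_configAt_subset_Icc hx fun y hy => ⟨ha hy, hb hy⟩))

/-! ### Opening a site at random -/

instance isProbabilityMeasure_P (p : I) : IsProbabilityMeasure (P p) := by unfold P; infer_instance

theorem bernoulliMeasure_true (p : I) :
    bernoulliMeasure true false p {true} = ENNReal.ofReal p := by
  rw [bernoulliMeasure_apply_of_mem_of_notMem p (by measurability) (by simp) (by simp)]
  simp [ENNReal.ofReal, Real.toNNReal_of_nonneg p.2.1]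
  rfl

/-- Resampling the state of one site does not change `P_p`. -/
theorem map_update_P (p : I) (o : Site) :
    ((P p).prod (bernoulliMeasure true false p)).map (fun q => Function.update q.1 o q.2) = P p := by
  classical
  refine Measure.eq_infinitePi _ fun s t ht => ?_
  rw [Measure.map_apply (by fun_prop)
    (MeasurableSet.pi s.countable_toSet fun i _ => ht i)]
  have : (fun q : Config × Bool => Function.update q.1 o q.2) ⁻¹' Set.pi s t =
      Set.pi (s.erase o : Finset Site) t ×ˢ (if o ∈ s then t o else Set.univ) := by
    ext ⟨ω, b⟩
    simp only [Set.mem_preimage, Set.mem_pi, Set.mem_prod, Finset.coe_erase]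
    constructor
    · intro h
      refine ⟨fun i hi => ?_, ?_⟩
      · have := h i hi.1
        rwa [Function.update_of_ne hi.2] at this
      · split_ifs with ho
        · simpa using h o ho
        · trivial
    · rintro ⟨h1, h2⟩ i hi
      by_cases hio : i = o
      · subst hio
        have hi' : i ∈ s := hi
        simpa [hi'] using h2
      · rw [Function.update_of_ne hio]
        exact h1 i ⟨hi, hio⟩
  rw [this, Measure.prod_prod, P, Measure.infinitePi_pi _ fun i _ => ht i]
  split_ifs with ho
  · rw [mul_comm, Finset.mul_prod_erase s (fun i => bernoulliMeasure true false p (t i)) ho]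
  · rw [Finset.erase_eq_of_notMem ho]; simp

/-- The price of opening a site: `P_p` of the event that `A` holds once `o` is opened is at most
`p⁻¹ P_p(A)`. -/
theorem mul_measure_update_le (p : I) (o : Site) (A : Set Config) :
    (p : ℝ) * (P p).real {ω | Function.update ω o true ∈ A} ≤ (P p).real A := by
  have hT : Measurable fun q : Config × Bool => Function.update q.1 o q.2 := by fun_prop
  have h1 : ENNReal.ofReal p * P p {ω | Function.update ω o true ∈ A} ≤ P p A := by
    calc _ = ((P p).prod (bernoulliMeasure true false p))
          ({ω | Function.update ω o true ∈ A} ×ˢ {true}) := by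
          rw [Measure.prod_prod, bernoulliMeasure_true, mul_comm]
      _ ≤ ((P p).prod (bernoulliMeasure true false p))
          ((fun q => Function.update q.1 o q.2) ⁻¹' A) := by
          refine measure_mono ?_
          rintro ⟨ω, b⟩ ⟨h, rfl⟩
          exact h
      _ ≤ _ := by
          conv_rhs => rw [← map_update_P p o]
          exact Measure.le_map_apply hT.aemeasurable A
  have := ENNReal.toReal_mono (measure_ne_top _ _) h1
  rwa [ENNReal.toReal_mul, ENNReal.toReal_ofReal p.2.1] at this

theorem le_update_true (ω : Config) (o : Site) : ω ≤ Function.update ω o true := by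
  intro x hx
  by_cases h : x = o
  · subst h; simp
  · rwa [Function.update_of_ne h]

theorem mul_thetaAt_le (p : I) (n : ℕ∞) : (p : ℝ) * thetaAt p n ≤ theta p := by
  refine le_trans (mul_le_mul_of_nonneg_left (measureReal_mono fun ω hω => ?_) p.2.1)
    (mul_measure_update_le p 0 _)
  exact infinite_cluster_of_configAt (n := n) (by simp)
    (Set.Infinite.mono (cluster_mono (configAt_mono n (le_update_true ω 0)) 0) hω)

theorem sq_mul_tauAt_le (p : I) (n : ℕ∞) (x : Site) : (p : ℝ) ^ 2 * tauAt p n x ≤ tau p x := by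
  rw [sq, mul_assoc]
  refine le_trans (mul_le_mul_of_nonneg_left ((mul_le_mul_of_nonneg_left
    (measureReal_mono fun ω hω => ?_) p.2.1).trans (mul_measure_update_le p x
      {ω | OpenConnected (Function.update ω 0 true) 0 x})) p.2.1)
    (mul_measure_update_le p 0 {ω | OpenConnected ω 0 x})
  have hle : Function.update ω x true ≤ _ := le_update_true (Function.update ω x true) 0
  exact openConnected_of_configAt (n := n) (by simp) (hle x (by simp))
    (hω.mono (configAt_mono n ((le_update_true ω x).trans hle)))

theorem theta_le_thetaAt (p : I) (n : ℕ∞) : theta p ≤ thetaAt p n :=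
  measureReal_mono fun ω hω => Set.Infinite.mono (cluster_mono (le_configAt n ω) 0) hω

theorem tau_le_tauAt (p : I) (n : ℕ∞) (x : Site) : tau p x ≤ tauAt p n x :=
  measureReal_mono fun ω hω => OpenConnected.mono (le_configAt n ω) hω

/-! ### No percolation at small density -/

theorem P_real_forall_open (p : I) (s : Finset Site) :
    (P p).real {ω | ∀ x ∈ s, ω x = true} = (p : ℝ) ^ s.card := by
  have : {ω : Config | ∀ x ∈ s, ω x = true} = Set.pi s fun _ => {true} := by
    ext; simp [Set.pi]
  rw [this, measureReal_def, P, Measure.infinitePi_pi _ fun _ _ => by measurability]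
  simp

/-- The vertex lists of the walks with `n` steps from `x` whose steps go to nearby sites. -/
noncomputable def walkLists : ℕ → Site → Finset (List Site)
  | 0, x => {[x]}
  | n + 1, x => (Finset.Icc (x - 1) (x + 1)).biUnion fun y => (walkLists n y).image (x :: ·)

theorem card_walkLists_le (n : ℕ) (x : Site) : (walkLists n x).card ≤ 9 ^ n := by
  induction n generalizing x with
  | zero => simp [walkLists]
  | succ n ih =>
    rw [walkLists, pow_succ']
    refine Finset.card_biUnion_le.trans ((Finset.sum_le_card_nsmul _ _ (9 ^ n) fun y _ =>
      Finset.card_image_le.trans (ih y)).trans (le_of_eq ?_))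
    rw [smul_eq_mul, Finset.card_Icc_prod]
    congr 1
    have h : ∀ a : ℤ, a + 1 + 1 - (a - 1) = 3 := fun a => by ring
    simp [h]

theorem support_mem_walkLists {x y : Site} (w : cpLattice.Walk x y) :
    w.support ∈ walkLists w.length x := by
  induction w with
  | nil => simp [walkLists]
  | @cons u v _ h w ih =>
    simp only [SimpleGraph.Walk.length_cons, walkLists, SimpleGraph.Walk.support_cons,
      Finset.mem_biUnion, Finset.mem_image]
    refine ⟨v, ?_, w.support, ih, rfl⟩
    have h1 := abs_le.1 h.2.1
    have h2 := abs_le.1 h.2.2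
    simp only [Finset.mem_Icc, Prod.le_def, Prod.fst_sub, Prod.snd_sub, Prod.fst_add, Prod.snd_add,
      Prod.fst_one, Prod.snd_one]
    omega

theorem abs_sub_le_length {x y : Site} (w : cpLattice.Walk x y) :
    |x.1 - y.1| ≤ w.length ∧ |x.2 - y.2| ≤ w.length := by
  induction w with
  | nil => simp
  | cons h w ih =>
    have h1 := abs_le.1 h.2.1
    have h2 := abs_le.1 h.2.2
    simp only [abs_le, SimpleGraph.Walk.length_cons] at ih ⊢
    push_cast
    omega

/-- An infinite open cluster contains open paths of every length. -/
theorem exists_path_of_infinite_cluster {ω : Config} {x : Site} (h : (cluster ω x).Infinite)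
    (n : ℕ) : ∃ l ∈ walkLists n x, l.Nodup ∧ l.length = n + 1 ∧ ∀ z ∈ l, ω z = true := by
  obtain ⟨y, hy, hyn⟩ := h.exists_notMem_finite
    (Set.finite_Icc (x - ((n : ℤ), (n : ℤ))) (x + ((n : ℤ), (n : ℤ))))
  obtain ⟨w, hp, hw⟩ := hy
  have hn : n ≤ w.length := by
    by_contra! hlt
    refine hyn ?_
    have := abs_sub_le_length w
    simp only [abs_le] at this
    simp only [Set.mem_Icc, Prod.le_def, Prod.fst_sub, Prod.snd_sub, Prod.fst_add, Prod.snd_add]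
    omega
  have hl : (w.take n).length = n := by simp [hn]
  refine ⟨(w.take n).support, ?_, (hp.take n).support_nodup, by simp [hn], fun z hz => ?_⟩
  · have := support_mem_walkLists (w.take n)
    rwa [hl] at this
  · exact hw z ((w.isSubwalk_take n).support_subset hz)

theorem theta_le_pow (p : I) (n : ℕ) : theta p ≤ (9 * p : ℝ) ^ n := by
  calc theta p
      ≤ (P p).real (⋃ l ∈ (walkLists n 0).filter fun l => l.Nodup ∧ l.length = n + 1,
          {ω | ∀ z ∈ l.toFinset, ω z = true}) := by
        refine measureReal_mono (fun ω hω => ?_) (measure_ne_top _ _)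
        obtain ⟨l, hl, h1, h2, h3⟩ := exists_path_of_infinite_cluster hω n
        simp only [Set.mem_iUnion, Finset.mem_filter]
        exact ⟨l, ⟨hl, h1, h2⟩, fun z hz => h3 z (by simpa using hz)⟩
    _ ≤ ∑ l ∈ (walkLists n 0).filter fun l => l.Nodup ∧ l.length = n + 1,
          (P p).real {ω | ∀ z ∈ l.toFinset, ω z = true} := measureReal_biUnion_finset_le _ _
    _ ≤ ∑ l ∈ (walkLists n 0).filter fun l => l.Nodup ∧ l.length = n + 1, (p : ℝ) ^ n := by
        refine Finset.sum_le_sum fun l hl => ?_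
        obtain ⟨-, h1, h2⟩ := Finset.mem_filter.1 hl
        rw [P_real_forall_open, List.toFinset_card_of_nodup h1, h2]
        exact pow_le_pow_of_le_one p.2.1 p.2.2 n.le_succ
    _ ≤ (9 : ℝ) ^ n * (p : ℝ) ^ n := by
        rw [Finset.sum_const, nsmul_eq_mul]
        refine mul_le_mul_of_nonneg_right ?_ (pow_nonneg p.2.1 n)
        exact_mod_cast (Finset.card_filter_le _ _).trans (card_walkLists_le n 0)
    _ = _ := (mul_pow _ _ _).symm

theorem theta_eq_zero {p : I} (hp : (p : ℝ) < 1 / 9) : theta p = 0 := by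
  refine le_antisymm ?_ measureReal_nonneg
  have h0 : (0 : ℝ) ≤ 9 * p := mul_nonneg (by norm_num) p.2.1
  exact ge_of_tendsto' (tendsto_pow_atTop_nhds_zero_of_lt_one h0 (by linarith)) (theta_le_pow p)

/-- For `p < 1/9` both sides vanish; for `p ≥ 1/9` the factor `p⁻¹` is at most `9`. -/
theorem thetaAt_le_mul_theta {p : I} (hp : (0 : ℝ) < p) (n : ℕ∞) :
    thetaAt p n ≤ 9 * theta p := by
  have h := mul_thetaAt_le p n
  have h0 : 0 ≤ thetaAt p n := measureReal_nonneg
  rcases lt_or_ge (p : ℝ) (1 / 9) with hlt | hge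
  · rw [theta_eq_zero hlt] at h ⊢
    nlinarith
  · nlinarith

theorem pcStar_nonneg : 0 ≤ pcStar := by
  refine Real.sInf_nonneg ?_
  rintro q ⟨p, rfl, -⟩
  exact p.2.1

/-! ### The Harris inequality -/

/-- The configuration that is closed outside `s` and given by `η` on `s`. -/
def extendClosed (s : Finset Site) (η : s → Bool) : Config :=
  fun x => if h : x ∈ s then η ⟨x, h⟩ else false

theorem extendClosed_mono (s : Finset Site) : Monotone (extendClosed s) := by
  intro η η' h x
  unfold extendClosed
  split_ifs with hx
  · exact h _
  · exact le_rfl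

theorem extendClosed_restrict_eq_true_iff {s : Finset Site} {ω : Config} {x : Site} :
    extendClosed s (s.restrict ω) x = true ↔ x ∈ s ∧ ω x = true := by
  unfold extendClosed
  split_ifs with h <;> simp [h]

theorem P_real_restrict_preimage (p : I) (s : Finset Site) (A : Set (s → Bool)) :
    (P p).real (s.restrict ⁻¹' A) =
      ∑ η, (Measure.pi fun _ : s => bernoulliMeasure true false p).real {η} *
        A.indicator 1 η := by
  classical
  rw [P, ← map_measureReal_apply (by fun_prop) (Set.toFinite A).measurableSet,
    Measure.infinitePi_map_restrict, ← Set.coe_toFinset A, ← sum_measureReal_singleton]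
  simp [Set.indicator_apply, Finset.sum_ite]

/-- The Harris inequality for increasing events that depend on finitely many sites. -/
theorem harris_finite (p : I) (s : Finset Site) {A B : Set (s → Bool)} (hA : IsUpperSet A)
    (hB : IsUpperSet B) : (P p).real (s.restrict ⁻¹' A) * (P p).real (s.restrict ⁻¹' B) ≤
      (P p).real (s.restrict ⁻¹' (A ∩ B)) := by
  classical
  simp only [P_real_restrict_preimage]
  set μ : (s → Bool) → ℝ :=
    fun η => (Measure.pi fun _ : s => bernoulliMeasure true false p).real {η} with hμ
  have hprod : ∀ η, μ η = ∏ i, (bernoulliMeasure true false p).real {η i} := fun η => by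
    rw [hμ]; simp only [measureReal_def, ← Set.univ_pi_singleton, Measure.pi_pi,
      ENNReal.toReal_prod]
  have hmono : ∀ A : Set (s → Bool), IsUpperSet A → Monotone (A.indicator (1 : (s → Bool) → ℝ)) := by
    intro A hA η η' h
    by_cases hη : η ∈ A
    · rw [Set.indicator_of_mem hη, Set.indicator_of_mem (hA h hη)]; exact le_rfl
    · rw [Set.indicator_of_notMem hη]
      exact Set.indicator_nonneg (fun _ _ => zero_le_one) _
  have hnn : ∀ A : Set (s → Bool), 0 ≤ A.indicator (1 : (s → Bool) → ℝ) :=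
    fun A η => Set.indicator_nonneg (fun _ _ => zero_le_one) _
  have hsum : ∑ η, μ η = 1 := by
    simp only [hμ, sum_measureReal_singleton, Finset.coe_univ, probReal_univ]
  -- for a product measure on `{0, 1}^s` the lattice condition holds with equality, factor by factor
  have h := fkg (μ := μ) (f := A.indicator 1) (g := B.indicator 1) (fun η => measureReal_nonneg)
    (hnn A) (hnn B) (hmono A hA) (hmono B hB) fun η η' => by
      simp only [hprod, ← Finset.prod_mul_distrib]
      refine Finset.prod_le_prod (fun i _ => by positivity) fun i _ => ?_
      simp only [Pi.inf_apply, Pi.sup_apply]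
      cases η i <;> cases η' i <;> simp [mul_comm]
  rw [hsum, one_mul] at h
  simpa [Set.inter_indicator_one] using h

/-- The square box of side length `2N + 1` around the origin. -/
noncomputable def box (N : ℕ) : Finset Site := Finset.Icc (-N, -N) (N, N)

theorem mem_box {N : ℕ} {x : Site} : x ∈ box N ↔ |x.1| ≤ N ∧ |x.2| ≤ N := by
  simp only [box, Finset.mem_Icc, Prod.le_def, abs_le]; tauto

theorem box_mono : Monotone box := by
  intro M N h x hx
  rw [mem_box] at hx ⊢
  omega

theorem exists_subset_box (s : Finset Site) : ∃ N, s ⊆ box N := by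
  refine ⟨s.sup fun x => x.1.natAbs ⊔ x.2.natAbs, fun x hx => ?_⟩
  have := sup_le_iff.1 (Finset.le_sup (f := fun x : Site => x.1.natAbs ⊔ x.2.natAbs) hx)
  rw [mem_box, abs_le, abs_le]
  omega

/-- An increasing event is finitary if whenever it occurs it already does so because of the open
sites of some box. -/
def Finitary (A : Set Config) : Prop :=
  ∀ ω ∈ A, ∃ N, extendClosed (box N) ((box N).restrict ω) ∈ A

theorem extendClosed_box_mono (ω : Config) :
    Monotone fun N => extendClosed (box N) ((box N).restrict ω) := by
  intro M N h x hx
  rw [extendClosed_restrict_eq_true_iff] at hx ⊢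
  exact ⟨box_mono h hx.1, hx.2⟩

/-- The probability of a finitary increasing event is the limit of those of its restrictions to
boxes. -/
theorem tendsto_P_real_box (p : I) {A : Set Config} (hA : IsUpperSet A) (hf : Finitary A) :
    Tendsto (fun N => (P p).real ((box N).restrict ⁻¹' (extendClosed (box N) ⁻¹' A))) atTop
      (𝓝 ((P p).real A)) := by
  have hU : A = ⋃ N, (box N).restrict ⁻¹' (extendClosed (box N) ⁻¹' A) := by
    ext ω
    simp only [Set.mem_iUnion]
    refine ⟨hf ω, fun ⟨N, hN⟩ => hA (fun x hx => ?_) hN⟩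
    exact (extendClosed_restrict_eq_true_iff.1 hx).2
  have hm : Monotone fun N => (box N).restrict ⁻¹' (extendClosed (box N) ⁻¹' A) :=
    fun M N h ω hω => hA (extendClosed_box_mono ω h) hω
  conv => enter [3, 1]; rw [hU]
  exact (ENNReal.tendsto_toReal (measure_ne_top _ _)).comp (tendsto_measure_iUnion_atTop hm)

/-- The Harris inequality: finitary increasing events are positively correlated. -/
theorem harris (p : I) {A B : Set Config} (hA : IsUpperSet A) (hB : IsUpperSet B)
    (hfA : Finitary A) (hfB : Finitary B) :
    (P p).real A * (P p).real B ≤ (P p).real (A ∩ B) := by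
  refine le_of_tendsto_of_tendsto' ((tendsto_P_real_box p hA hfA).mul (tendsto_P_real_box p hB hfB))
    tendsto_const_nhds fun N => ?_
  refine (harris_finite p (box N) (hA.preimage (extendClosed_mono _))
    (hB.preimage (extendClosed_mono _))).trans (measureReal_mono fun ω hω => ?_)
  have hle : extendClosed (box N) ((box N).restrict ω) ≤ ω :=
    fun x hx => (extendClosed_restrict_eq_true_iff.1 hx).2
  exact ⟨hA hle hω.1, hB hle hω.2⟩

theorem isUpperSet_openConnected (x y : Site) : IsUpperSet {ω | OpenConnected ω x y} :=
  fun _ _ h hω => OpenConnected.mono h hω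

theorem finitary_openConnected (x y : Site) : Finitary {ω | OpenConnected ω x y} := by
  rintro ω ⟨w, hp, hw⟩
  obtain ⟨N, hN⟩ := exists_subset_box w.support.toFinset
  exact ⟨N, w, hp, fun z hz =>
    extendClosed_restrict_eq_true_iff.2 ⟨hN (by simpa using hz), hw z hz⟩⟩

/-! ### Connectivity functions and correlation lengths -/

/-- One half of the translation invariance of the connectivity function. -/
theorem tau_le_translate (p : I) (v x : Site) :
    tau p x ≤ (P p).real {ω | OpenConnected ω v (v + x)} := by
  have hmp : (P p).map (MeasurableEquiv.piCongrLeft (fun _ => Bool) (Equiv.addLeft v)) = P p :=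
    Measure.infinitePi_map_piCongrLeft (μ := fun _ : Site => bernoulliMeasure true false p)
      (Equiv.addLeft v)
  refine ENNReal.toReal_mono (measure_ne_top _ _) ?_
  conv_rhs => rw [← hmp]
  refine le_trans (measure_mono fun ω hω => ?_)
    (Measure.le_map_apply (MeasurableEquiv.measurable _).aemeasurable _)
  set ω' : Config := MeasurableEquiv.piCongrLeft (fun _ => Bool) (Equiv.addLeft v) ω with hω'
  have hsh : ∀ z, ω' (v + z) = ω z := fun z => by
    rw [hω', MeasurableEquiv.coe_piCongrLeft]
    exact Equiv.piCongrLeft_apply_apply (fun _ => Bool) (Equiv.addLeft v) ω z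
  have hω0 : OpenConnected ω 0 x := hω
  refine hω0.mem_of_closed {z | OpenConnected ω' v (v + z)} ?_ fun z z' hz hn hz' => ?_
  · have : ω' (v + 0) = true := (hsh 0).trans hω0.left
    rw [add_zero] at this
    simpa using OpenConnected.refl this
  · exact OpenConnected.trans hz (.of_near hz.right ((hsh z').trans hz')
      (by simpa [Near] using hn))

/-- By the Harris inequality and translation invariance, `τ_p` is supermultiplicative. -/
theorem tau_mul_tau_le (p : I) (x y : Site) : tau p x * tau p y ≤ tau p (x + y) :=
  calc tau p x * tau p y
      ≤ tau p x * (P p).real {ω | OpenConnected ω x (x + y)} :=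
        mul_le_mul_of_nonneg_left (tau_le_translate p x y) measureReal_nonneg
    _ ≤ (P p).real ({ω | OpenConnected ω 0 x} ∩ {ω | OpenConnected ω x (x + y)}) :=
        harris p (isUpperSet_openConnected 0 x) (isUpperSet_openConnected x (x + y))
          (finitary_openConnected 0 x) (finitary_openConnected x (x + y))
    _ ≤ tau p (x + y) := measureReal_mono fun ω hω => OpenConnected.trans hω.1 hω.2

theorem openConnected_all_open (x : Site) : OpenConnected (fun _ => true) 0 x := by
  obtain ⟨a, b⟩ := x
  have h1 : ∀ a : ℤ, OpenConnected (fun _ => true) (0 : Site) (a, 0) := fun a => by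
    induction a using Int.induction_on with
    | zero => exact .refl rfl
    | succ i ih => exact ih.trans (.of_near rfl rfl (by simp [Near]))
    | pred i ih => exact ih.trans (.of_near rfl rfl (by simp [Near]))
  refine (h1 a).trans ?_
  induction b using Int.induction_on with
  | zero => exact .refl rfl
  | succ i ih => exact ih.trans (.of_near rfl rfl (by simp [Near]))
  | pred i ih => exact ih.trans (.of_near rfl rfl (by simp [Near]))

theorem tau_pos {p : I} (hp : (0 : ℝ) < p) (x : Site) : 0 < tau p x := by
  obtain ⟨w, hw, -⟩ := openConnected_all_open x
  calc (0 : ℝ) < (p : ℝ) ^ w.support.toFinset.card := pow_pos hp _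
    _ = (P p).real {ω | ∀ z ∈ w.support.toFinset, ω z = true} := (P_real_forall_open p _).symm
    _ ≤ tau p x := measureReal_mono fun ω hω => ⟨w, hw, fun z hz => hω z (by simpa using hz)⟩

theorem tau_le_one (p : I) (x : Site) : tau p x ≤ 1 := measureReal_le_one

theorem euclideanLength_nsmul (k : ℕ) (v : Site) :
    euclideanLength (k • v) = k * euclideanLength v := by
  have h1 : (k • v).1 = k * v.1 := by rw [Prod.smul_fst, nsmul_eq_mul]
  have h2 : (k • v).2 = k * v.2 := by rw [Prod.smul_snd, nsmul_eq_mul]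
  rw [euclideanLength, euclideanLength, h1, h2]
  push_cast
  rw [mul_pow, mul_pow, ← mul_add, Real.sqrt_mul (by positivity), Real.sqrt_sq k.cast_nonneg]

/-- Fekete's lemma: along a lattice ray the correlation length of `τ_p` exists, because
`k ↦ -log τ_p(k v)` is subadditive. -/
theorem exists_isCorrelationLength_alongRay {p : I} (hp : (0 : ℝ) < p) (v : Site) :
    ∃ ξ : ℝ≥0∞, IsCorrelationLength (alongRay v) (tau p) ξ := by
  set u : ℕ → ℝ := fun k => -Real.log (tau p (k • v)) with hu
  have hsub : Subadditive u := fun m n => by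
    simp only [hu, add_smul]
    rw [← neg_add, neg_le_neg_iff, ← Real.log_mul (tau_pos hp _).ne' (tau_pos hp _).ne']
    exact Real.log_le_log (mul_pos (tau_pos hp _) (tau_pos hp _)) (tau_mul_tau_le p _ _)
  have hbdd : BddBelow (Set.range fun n : ℕ => u n / n) := by
    refine ⟨0, ?_⟩
    rintro _ ⟨n, rfl⟩
    exact div_nonneg (neg_nonneg.2 (Real.log_nonpos (tau_pos hp _).le (tau_le_one p _)))
      n.cast_nonneg
  refine ⟨(ENNReal.ofReal (hsub.lim / euclideanLength v))⁻¹, ?_⟩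
  rw [IsCorrelationLength, inv_inv, alongRay, tendsto_map'_iff]
  refine (ENNReal.continuous_ofReal.tendsto _).comp
    (((hsub.tendsto_lim hbdd).div_const (euclideanLength v)).congr fun k => ?_)
  simp only [hu, euclideanLength_nsmul]
  rw [div_div, div_eq_mul_inv, one_div, neg_mul_comm, mul_comm]

/-- Extended nonnegative functions that differ by at most an error tending to `0` have the same
limits, finite or infinite. -/
theorem tendsto_of_le_add {α : Type*} {l : Filter α} {F G e : α → ℝ≥0∞} {a : ℝ≥0∞}
    (he : Tendsto e l (𝓝 0)) (h1 : ∀ x, F x ≤ G x + e x) (h2 : ∀ x, G x ≤ F x + e x)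
    (hF : Tendsto F l (𝓝 a)) : Tendsto G l (𝓝 a) := by
  have hsub : Tendsto (fun x => F x - e x) l (𝓝 a) := by
    simpa using ENNReal.Tendsto.sub hF he (.inr ENNReal.zero_ne_top)
  exact tendsto_of_tendsto_of_tendsto_of_le_of_le hsub (by simpa using hF.add he)
    (fun x => tsub_le_iff_right.2 (h1 x)) h2

/-- Connectivity functions that agree up to a constant factor have the same correlation length. -/
theorem isCorrelationLength_iff_of_le_mul {l : Filter Site} (hl : l ≤ atInfinity)
    {τ τ' : Site → ℝ} {K : ℝ} (hK : 1 ≤ K) (hpos : ∀ x, 0 < τ x) (hle : ∀ x, τ x ≤ τ' x)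
    (hle' : ∀ x, τ' x ≤ K * τ x) (ξ : ℝ≥0∞) :
    IsCorrelationLength l τ' ξ ↔ IsCorrelationLength l τ ξ := by
  have hlen : ∀ x : Site, 0 ≤ 1 / euclideanLength x := fun x =>
    one_div_nonneg.2 (Real.sqrt_nonneg _)
  have he : Tendsto (fun x => ENNReal.ofReal (1 / euclideanLength x * Real.log K)) l (𝓝 0) := by
    have : Tendsto (fun x => 1 / euclideanLength x * Real.log K) l (𝓝 0) := by
      have h := ((tendsto_inv_atTop_zero.comp tendsto_comap).mono_left hl).mul_const (Real.log K)
      simpa [Function.comp_def] using h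
    simpa [Function.comp_def] using (ENNReal.continuous_ofReal.tendsto _).comp this
  have h1 : ∀ x, Real.log (τ x) ≤ Real.log (τ' x) := fun x => Real.log_le_log (hpos x) (hle x)
  have h2 : ∀ x, Real.log (τ' x) ≤ Real.log K + Real.log (τ x) := fun x => by
    rw [← Real.log_mul (by positivity) (hpos x).ne']
    exact Real.log_le_log ((hpos x).trans_le (hle x)) (hle' x)
  have hA : ∀ x, ENNReal.ofReal (-(1 / euclideanLength x) * Real.log (τ' x)) ≤
      ENNReal.ofReal (-(1 / euclideanLength x) * Real.log (τ x)) := fun x =>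
    ENNReal.ofReal_le_ofReal (by nlinarith [mul_le_mul_of_nonneg_left (h1 x) (hlen x)])
  have hB : ∀ x, ENNReal.ofReal (-(1 / euclideanLength x) * Real.log (τ x)) ≤
      ENNReal.ofReal (-(1 / euclideanLength x) * Real.log (τ' x)) +
        ENNReal.ofReal (1 / euclideanLength x * Real.log K) := fun x =>
    (ENNReal.ofReal_le_ofReal (by nlinarith [mul_le_mul_of_nonneg_left (h2 x) (hlen x)])).trans
      ENNReal.ofReal_add_le
  exact ⟨tendsto_of_le_add he (fun x => (hA x).trans le_self_add) hB,
    tendsto_of_le_add he hB fun x => (hA x).trans le_self_add⟩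

theorem alongRay_le_atInfinity {v : Site} (hv : v ≠ 0) : alongRay v ≤ atInfinity := by
  rw [alongRay, atInfinity, ← tendsto_iff_comap, tendsto_map'_iff]
  have hv' : 0 < euclideanLength v := by
    refine Real.sqrt_pos.2 ?_
    have : v.1 ≠ 0 ∨ v.2 ≠ 0 := by
      by_contra! h
      exact hv (Prod.ext h.1 h.2)
    rcases this with h | h
    · have : (v.1 : ℝ) ≠ 0 := by exact_mod_cast h
      positivity
    · have : (v.2 : ℝ) ≠ 0 := by exact_mod_cast h
      positivity
  refine (tendsto_natCast_atTop_atTop.atTop_mul_const hv').congr fun k => ?_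
  simp only [Function.comp_apply, euclideanLength_nsmul]

end BootstrapPercolation

open BootstrapPercolation
open scoped unitInterval ENNReal
theorem theorem3p2 :
    ∃ c₁ c₂ : ℝ, 0 < c₁ ∧ 0 < c₂ ∧ ∀ n : ℕ∞, 1 ≤ n →
      (∀ p : I, pcStar < p → theta p ≤ thetaAt p n ∧ thetaAt p n ≤ c₁ * theta p) ∧
      (∀ p : I, 0 < p → (p : ℝ) ≤ pcStar → ∀ x : Site,
        tau p x ≤ tauAt p n x ∧ tauAt p n x ≤ (p : ℝ) ^ (-c₂) * tau p x) ∧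
      (∀ p : I, 0 < p → (p : ℝ) ≤ pcStar →
        (∀ l : Filter Site, l ≤ atInfinity → ∀ ξ : ℝ≥0∞,
          IsCorrelationLength l (tauAt p n) ξ ↔ IsCorrelationLength l (tau p) ξ) ∧
        (∀ v : Site, v ≠ 0 → ∃ ξ : ℝ≥0∞,
          IsCorrelationLength (alongRay v) (tau p) ξ ∧
          IsCorrelationLength (alongRay v) (tauAt p n) ξ)) := by
  have hpos : ∀ p : I, 0 < p → (0 : ℝ) < p := fun p hp => hp
  have htau : ∀ n (p : I), 0 < p → ∀ x, tauAt p n x ≤ (p : ℝ) ^ (-2 : ℝ) * tau p x := by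
    intro n p hp x
    rw [Real.rpow_neg p.2.1, Real.rpow_two, inv_mul_eq_div, le_div_iff₀' (pow_pos (hpos p hp) 2)]
    exact sq_mul_tauAt_le p n x
  have hiff : ∀ n (p : I), 0 < p → ∀ l : Filter Site, l ≤ atInfinity → ∀ ξ : ℝ≥0∞,
      IsCorrelationLength l (tauAt p n) ξ ↔ IsCorrelationLength l (tau p) ξ := fun n p hp l hl =>
    isCorrelationLength_iff_of_le_mul hl
      (Real.one_le_rpow_of_pos_of_le_one_of_nonpos (hpos p hp) p.2.2 (by norm_num))
      (tau_pos (hpos p hp)) (tau_le_tauAt p n) (htau n p hp)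
  refine ⟨9, 2, by norm_num, by norm_num, fun n _ => ⟨fun p hp => ?_, fun p hp _ x => ?_,
    fun p hp _ => ⟨hiff n p hp, fun v hv => ?_⟩⟩⟩
  · exact ⟨theta_le_thetaAt p n, thetaAt_le_mul_theta (pcStar_nonneg.trans_lt hp) n⟩
  · exact ⟨tau_le_tauAt p n x, htau n p hp x⟩
  · obtain ⟨ξ, hξ⟩ := exists_isCorrelationLength_alongRay (hpos p hp) v
    exact ⟨ξ, hξ, (hiff n p hp _ (alongRay_le_atInfinity hv) ξ).2 hξ⟩
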